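/- Consider a network of $M$ users, $N$ options and integers $1\le K\le N$. Whenever user $i$ selects option $j$ in a round, it receives a reward; the potential rewards of $i$ from $j$ in the rounds $t=1,2,\dots$ are i.i.d., with values in $[0,1]$ and mean $\mu^i_j$, and the reward of a round is independent of everything that was known before the round. For each user $i$ the means $\mu^i_1,\dots,\mu^i_N$ are pairwise distinct; $N^i_K$ denotes the set of the $K$ options with the highest means for user $i$, $\overline N^i_K$ its complement, $\mu^i_{(K)}=\min_{j\in N^i_K}\mu^i_j$ and $\Delta^i_j=\mu^i_{(K)}-\mu^i_j$. The users are divided into $G$ groups with pairwise distinct preferred sets $N^1_K,\dots,N^G_K$ (known $K$-element sets of options), so that all users of group $l$ have the top-$K$ set $N^l_K$. All users run the algorithm D_PART. Let $n^i_j(t)$ be the number of rounds up to $t$ in which user $i$ selected option $j$, and $r^i_j(t)$ the sample mean of the rewards collected by $i$ from $j$ up to round $t$. After $t$ rounds, the preference of user $k$ is estimated by a set $\tilde N^k_K(t)$ of $K$ options $j$ with the highest counts $n^k_j(t)$, and user $k$ is assigned to a group $l$ that maximizes $|\tilde N^k_K(t)\cap N^l_K|$ (ties broken arbitrarily, possibly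 at random). User $i$ computes the weights $$\beta^i_j(t)=\frac{\sum_{k}(n^k_j(t))^{\omega^{i,k}}}{\sum_{m=1}^N\sum_{k}(n^k_m(t))^{\omega^{i,k}}},$$ where $\omega^{i,k}=1$ if $i$ currently assigns $k$ to the same group as itself, and $\omega^{i,k}$ is a prescribed real number less than $1$ otherwise (a number depending on $i$ and $k$, and possibly on the overlap of $\tilde N^k_K(t)$ with the preferred set of the group to which $i$ assigns itself). In round $t+1$ user $i$ selects $K$ options with the highest values of the index $$r^i_j(t)-\alpha\,(1-\beta^i_j(t))\sqrt{\frac{\log t}{t}}+\sqrt{\frac{2\log t}{n^i_j(t)}},$$ which is $+\infty$ for options that $i$ has not tried yet; ties are broken without knowledge of future rewards, and $\alpha\in\mathbb R$ is a fixed weighting factor. Let $a^i(t)$ be the set of options selected by $i$ in round $t$, let $X^i_j(t)$ be its potential reward from option $j$ in round $t$, and let $$R^i_{\mathrm{D\_PART}}(T)=T\sum_{j\in N^i_K}\mu^i_j-\mathbb E\Big[\sum_{t=1}^{T}\sum_{j\in a^i(t)}X^i_j(t)\Big]$$ be the weak regret of user $i$. Theorem. For every user $i$ and every $\epsilon>0$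 there is a constant $C$, depending on the reward distributions, the groups, $\alpha$, the discount exponents, $i$ and $\epsilon$, but neither on $t$ nor on the way ties are broken, such that for all integers $t\ge 1$ $$R^i_{\mathrm{D\_PART}}(t)\le\sum_{j\in\overline N^i_K}\left\lceil\frac{(6+\epsilon)\log t}{\Delta^i_j}\right\rceil+C .$$ -/

import Mathlib

open MeasureTheory ProbabilityTheory

/-- `S` consists of `K` indices whose values under `f` are among the `K` highest
(ties broken arbitrarily). -/
def IsTopK {n : ℕ} {γ : Type*} [LE γ] (K : ℕ) (f : Fin n → γ) (S : Finset (Fin n)) : Prop :=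
  S.card = K ∧ ∀ j ∈ S, ∀ l ∉ S, f l ≤ f j

/-- A group learning problem with diverse preferences: `M` users, `N` options, `G` groups, and
`K` choices per user and round. -/
structure DiverseModel (M N G K : ℕ) where
  one_le_K : 1 ≤ K
  K_le_N : K ≤ N
  /-- The law of the reward that user `i` obtains from option `j`. -/
  law : Fin M → Fin N → Measure ℝ
  law_prob : ∀ i j, IsProbabilityMeasure (law i j)
  law_support : ∀ i j, ∀ᵐ x ∂(law i j), x ∈ Set.Icc (0 : ℝ) 1
  /-- Different options have different means for a user. -/
  mean_injective : ∀ i, Function.Injective fun j => ∫ x, x ∂(law i j)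
  /-- The group to which a user belongs. -/
  grp : Fin M → Fin G
  /-- The (known) preferred set of a group. -/
  pref : Fin G → Finset (Fin N)
  pref_card : ∀ l, (pref l).card = K
  /-- The preferred set differs from group to group. -/
  pref_injective : Function.Injective pref
  /-- The preferred set of the group of user `i` is the set of the top `K` options of `i`. -/
  pref_top : ∀ i, IsTopK K (fun j => ∫ x, x ∂(law i j)) (pref (grp i))

namespace DiverseModel

variable {M N G K : ℕ} (P : DiverseModel M N G K)

/-- The mean reward of user `i` from option `j`. -/
noncomputable def mean (i : Fin M) (j : Fin N) : ℝ := ∫ x, x ∂(P.law i j)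

/-- The set of the top `K` options of user `i`. -/
def topSet (i : Fin M) : Finset (Fin N) := P.pref (P.grp i)

theorem topSet_nonempty (i : Fin M) : (P.topSet i).Nonempty := by
  rw [← Finset.card_pos, topSet, P.pref_card]
  exact P.one_le_K

/-- The `K`-th highest mean of user `i`. -/
noncomputable def kthMean (i : Fin M) : ℝ :=
  (P.topSet i).inf' (P.topSet_nonempty i) (P.mean i)

/-- The gap between the `K`-th highest mean of user `i` and the mean of option `j`. -/
noncomputable def gap (i : Fin M) (j : Fin N) : ℝ := P.kthMean i - P.mean i j

end DiverseModel

/-- The quantities observed or computed by the users in one realization of the process.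
Rounds are numbered `1, 2, …`; entries of `reward` and `choice` at `0` are never used. -/
structure Trajectory (M N G : ℕ) where
  /-- `reward i j t` is the reward of user `i` from option `j` in round `t`
  (collected only if `i` selects `j`). -/
  reward : Fin M → Fin N → ℕ → ℝ
  /-- `choice i t` is the set of options selected by user `i` in round `t`. -/
  choice : Fin M → ℕ → Finset (Fin N)
  /-- `prefEst i k t` is the estimate by user `i` of the preferred set of user `k`
  after `t` rounds. -/
  prefEst : Fin M → Fin M → ℕ → Finset (Fin N)
  /-- `grpEst i k t` is the group to which user `i` assigns user `k` after `t` rounds. -/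
  grpEst : Fin M → Fin M → ℕ → Fin G

namespace Trajectory

variable {M N G K : ℕ}

/-- The number of rounds up to `t` in which user `i` selected option `j`. -/
def count (τ : Trajectory M N G) (i : Fin M) (j : Fin N) (t : ℕ) : ℕ :=
  ((Finset.Icc 1 t).filter fun m => j ∈ τ.choice i m).card

/-- The sample mean of the rewards collected by user `i` from option `j` up to round `t`. -/
noncomputable def sampleMean (τ : Trajectory M N G) (i : Fin M) (j : Fin N) (t : ℕ) : ℝ :=
  (∑ m ∈ Finset.Icc 1 t, if j ∈ τ.choice i m then τ.reward i j m else 0) / τ.count i j t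

/-- The exponent that user `i` applies to the selections of user `k`: it is `1` if `i` assigns
`k` to the group to which it assigns itself, and otherwise the discount exponent
`disc i k d`, where `d` is the overlap of the estimated preferred set of `k` with the preferred
set of that group (a constant exponent is the case where `disc i k` ignores `d`). -/
noncomputable def exponent (τ : Trajectory M N G) (P : DiverseModel M N G K)
    (disc : Fin M → Fin M → ℕ → ℝ) (i k : Fin M) (t : ℕ) : ℝ :=
  if τ.grpEst i k t = τ.grpEst i i t then 1
  else disc i k (τ.prefEst i k t ∩ P.pref (τ.grpEst i i t)).card

/-- The discounted group frequency of option `j`, as computed by user `i` after `t` rounds. -/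
noncomputable def groupFreq (τ : Trajectory M N G) (P : DiverseModel M N G K)
    (disc : Fin M → Fin M → ℕ → ℝ) (i : Fin M) (j : Fin N) (t : ℕ) : ℝ :=
  (∑ k : Fin M, (τ.count k j t : ℝ) ^ τ.exponent P disc i k t) /
    ∑ m : Fin N, ∑ k : Fin M, (τ.count k m t : ℝ) ^ τ.exponent P disc i k t

/-- The D_PART index of option `j` for user `i` after `t` rounds. It is infinite if user `i` has
not tried option `j` yet. -/
noncomputable def index (τ : Trajectory M N G) (P : DiverseModel M N G K) (α : ℝ)
    (disc : Fin M → Fin M → ℕ → ℝ) (i : Fin M) (j : Fin N) (t : ℕ) : EReal :=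
  if τ.count i j t = 0 then ⊤
  else ((τ.sampleMean i j t
      - α * (1 - τ.groupFreq P disc i j t) * √(Real.log t / t)
      + √(2 * Real.log t / τ.count i j t) : ℝ) : EReal)

/-- The realization `τ` obeys the D_PART algorithm. -/
structure FollowsDPart (τ : Trajectory M N G) (P : DiverseModel M N G K) (α : ℝ)
    (disc : Fin M → Fin M → ℕ → ℝ) : Prop where
  /-- The preference of user `k` is estimated by its `K` most frequently selected options. -/
  prefEst_top : ∀ i k t, IsTopK K (fun j => τ.count k j t) (τ.prefEst i k t)
  /-- User `k` is assigned to a group whose preferred set has maximal overlap with the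
  estimated one. -/
  grpEst_max : ∀ i k t l,
    (τ.prefEst i k t ∩ P.pref l).card ≤ (τ.prefEst i k t ∩ P.pref (τ.grpEst i k t)).card
  /-- In round `t + 1` every user selects the `K` options of highest index after `t` rounds. -/
  choice_top : ∀ i t, IsTopK K (fun j => τ.index P α disc i j t) (τ.choice i (t + 1))

end Trajectory

/-- The random process generated when all users run D_PART on the problem `P`.
The filtration carries the information available after each round, possibly including
additional randomness used to break ties. -/
structure DPartProcess {M N G K : ℕ} (P : DiverseModel M N G K) (α : ℝ)
    (disc : Fin M → Fin M → ℕ → ℝ) {Ω : Type*} [mΩ : MeasurableSpace Ω] (μ : Measure Ω) where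
  /-- The realization of the process at a sample point. -/
  traj : Ω → Trajectory M N G
  /-- The information available after each round. -/
  ℱ : Filtration ℕ mΩ
  /-- The rewards of a round are determined by the end of that round. -/
  reward_measurable : ∀ i j t, Measurable[ℱ (t + 1)] fun w => (traj w).reward i j (t + 1)
  /-- All rewards of user `i` from option `j` have the law `P.law i j`. -/
  reward_law : ∀ i j t, μ.map (fun w => (traj w).reward i j (t + 1)) = P.law i j
  /-- Rewards are independent of the past. -/
  reward_indep : ∀ i j t,
    Indep (MeasurableSpace.comap (fun w => (traj w).reward i j (t + 1)) inferInstance) (ℱ t) μ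
  /-- The choices of round `t + 1` are made with the information available after round `t`. -/
  choice_measurable : ∀ i j t, MeasurableSet[ℱ t] {w | j ∈ (traj w).choice i (t + 1)}
  /-- All users obey D_PART. -/
  follows : ∀ w, (traj w).FollowsDPart P α disc

/-- The weak regret of user `i` after `T` rounds. -/
noncomputable def DPartProcess.weakRegret {M N G K : ℕ} {P : DiverseModel M N G K} {α : ℝ}
    {disc : Fin M → Fin M → ℕ → ℝ} {Ω : Type*} [MeasurableSpace Ω] {μ : Measure Ω}
    (A : DPartProcess P α disc μ) (i : Fin M) (T : ℕ) : ℝ :=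
  T * ∑ j ∈ P.topSet i, P.mean i j
    - ∫ w, ∑ t ∈ Finset.Icc 1 T, ∑ j ∈ (A.traj w).choice i t, (A.traj w).reward i j t ∂μ

/-! By predictability of the choices, the regret is the expected sum of the losses in mean of the
rounds. In one round, each selected inferior option `j` is charged with `D`, the largest mean
missing from the choice minus the mean of `j`. `D` may far exceed the gap of `j`, so counting
selections and multiplying by gaps is not enough.

If `j` has been selected `n ≥ 1` times and the confidence bounds hold, the index comparison forces
`D ≤ √(3 log t / n)`. Since `D` is at least the gap `δ`, this charge occurs only while `n δ² ≤ 3 log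
t`. Each `n` occurs at most once, and the charges sum to at most `6 log t / δ` (`sum_sqrt_div_le`).
The factor `6 + ε` and the ceiling only enlarge this bound.

Everything else costs `O(1)`. The group weights lie in `[0, 1]`, so the discount term is at most
`|α| √(log s / s)`, which is negligible from a fixed round on. Overestimates of `j` are summed over
the number `n` of selections, with probabilities decaying geometrically. Underestimates of top
options are summed over the rounds `s`, with probabilities at most `s⁻³`. Both bounds rest on a
Hoeffding inequality for the first `n` predictably selected rewards (`measure_exists_selSum_ge_le`).
-/

/-! ### Hoeffding's inequality under predictable selection. -/

section Hoeffding

variable {Ω : Type*}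

/-- The number of indices `m < t` for which `w` lies in `b m`. -/
noncomputable def selCount (b : ℕ → Set Ω) (t : ℕ) (w : Ω) : ℕ :=
  ∑ m ∈ Finset.range t, (b m).indicator (fun _ => 1) w

/-- The sum of those values `y m w` with `m < t` for which `w` lies in `b m`. -/
noncomputable def selSum (b : ℕ → Set Ω) (y : ℕ → Ω → ℝ) (t : ℕ) (w : Ω) : ℝ :=
  ∑ m ∈ Finset.range t, (b m).indicator (y m) w

theorem selCount_succ (b : ℕ → Set Ω) (t : ℕ) (w : Ω) :
    selCount b (t + 1) w = selCount b t w + (b t).indicator (fun _ => 1) w :=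
  Finset.sum_range_succ _ _

theorem selSum_succ (b : ℕ → Set Ω) (y : ℕ → Ω → ℝ) (t : ℕ) (w : Ω) :
    selSum b y (t + 1) w = selSum b y t w + (b t).indicator (y t) w :=
  Finset.sum_range_succ _ _

theorem selCount_mono (b : ℕ → Set Ω) (w : Ω) : Monotone fun t => selCount b t w :=
  monotone_nat_of_le_succ fun t => by rw [selCount_succ]; exact Nat.le_add_right _ _

theorem selCount_le (b : ℕ → Set Ω) (t : ℕ) (w : Ω) : selCount b t w ≤ t := by
  induction t with
  | zero => simp [selCount]
  | succ t ih =>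
    rw [selCount_succ]
    by_cases h : w ∈ b t <;> simp [h] <;> omega

/-- Reindexing by the number of earlier selections. -/
theorem sum_indicator_selCount (b : ℕ → Set Ω) (f : ℕ → ℝ) (t : ℕ) (w : Ω) :
    ∑ s ∈ Finset.range t, (b s).indicator (fun _ => f (selCount b s w)) w
      = ∑ n ∈ Finset.range (selCount b t w), f n := by
  induction t with
  | zero => simp [selCount]
  | succ t ih =>
    rw [Finset.sum_range_succ, ih, selCount_succ]
    by_cases h : w ∈ b t <;> simp [h, Finset.sum_range_succ]

/-- Selections stopped as soon as `n` of them have occurred. -/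
theorem selSum_stopped (b : ℕ → Set Ω) (y : ℕ → Ω → ℝ) {s t : ℕ} (hst : s ≤ t) (w : Ω) :
    selSum (fun m => b m ∩ {w' | selCount b m w' < selCount b s w}) y t w = selSum b y s w := by
  -- From `s` on, the count has reached its value at `s`, so nothing more is selected; a selection
  -- before `s` is itself counted at `s`, whence the strict inequality.
  have hle : ∀ m, s ≤ m → ¬ selCount b m w < selCount b s w :=
    fun m hm => not_lt.2 (selCount_mono b w hm)
  have hlt : ∀ m, m < s → w ∈ b m → selCount b m w < selCount b s w := by
    intro m hm hw
    have h1 : selCount b (m + 1) w ≤ selCount b s w := selCount_mono b w hm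
    rw [selCount_succ] at h1
    simp [hw] at h1
    omega
  unfold selSum
  rw [← Finset.sum_subset (Finset.range_mono hst)]
  · refine Finset.sum_congr rfl fun m hm => ?_
    by_cases hw : w ∈ b m
    · simp [hw, hlt m (Finset.mem_range.1 hm) hw]
    · simp [hw]
  · intro m _ hm
    simp [hle m (by simpa using hm)]

variable [mΩ : MeasurableSpace Ω] {μ : Measure Ω} {ℱ : Filtration ℕ mΩ}

theorem measurable_selCount {b : ℕ → Set Ω} (hb : ∀ m, MeasurableSet[ℱ m] (b m)) (t : ℕ) :
    Measurable[ℱ t] (selCount b t) := by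
  unfold selCount
  refine Finset.measurable_fun_sum _ fun m hm => ?_
  exact (measurable_const (a := (1 : ℕ))).indicator
    (ℱ.mono (Finset.mem_range.1 hm).le _ (hb m))

theorem measurable_selSum {b : ℕ → Set Ω} (hb : ∀ m, MeasurableSet[ℱ m] (b m))
    {y : ℕ → Ω → ℝ} (hy : ∀ m, Measurable[ℱ (m + 1)] (y m)) (t : ℕ) :
    Measurable[ℱ t] (selSum b y t) := by
  unfold selSum
  refine Finset.measurable_fun_sum _ fun m hm => ?_
  have hm := Finset.mem_range.1 hm
  exact ((hy m).mono (ℱ.mono hm) le_rfl).indicator (ℱ.mono hm.le _ (hb m))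

/-- A product of predictably selected factors of conditional mean at most one has mean at most
one. -/
theorem lintegral_exp_selSum_le_one [IsProbabilityMeasure μ]
    {b : ℕ → Set Ω} (hb : ∀ m, MeasurableSet[ℱ m] (b m))
    {y : ℕ → Ω → ℝ} (hy : ∀ m, Measurable[ℱ (m + 1)] (y m))
    (hind : ∀ m, Indep (MeasurableSpace.comap (y m) inferInstance) (ℱ m) μ)
    (hmean : ∀ m, ∫⁻ w, ENNReal.ofReal (Real.exp (y m w)) ∂μ ≤ 1) (t : ℕ) :
    ∫⁻ w, ENNReal.ofReal (Real.exp (selSum b y t w)) ∂μ ≤ 1 := by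
  induction t with
  | zero => simp [selSum]
  | succ t ih =>
    refine le_trans ?_ ih
    set Z : Ω → ENNReal := fun w => ENNReal.ofReal (Real.exp (selSum b y t w)) with hZ
    have hZm : Measurable[ℱ t] Z :=
      (Real.measurable_exp.comp (measurable_selSum hb hy t)).ennreal_ofReal
    have hbt : MeasurableSet (b t) := ℱ.le t _ (hb t)
    have hZm' : Measurable Z := hZm.mono (ℱ.le t) le_rfl
    have e : ∀ w, ENNReal.ofReal (Real.exp (selSum b y (t + 1) w))
        = (b t)ᶜ.indicator Z w
          + (b t).indicator Z w * ENNReal.ofReal (Real.exp (y t w)) := by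
      intro w
      rw [selSum_succ, Real.exp_add, ENNReal.ofReal_mul (Real.exp_nonneg _)]
      by_cases h : w ∈ b t <;> simp [h, hZ]
    simp_rw [e]
    rw [lintegral_add_left (hZm'.indicator hbt.compl)]
    -- On `b t`, the accumulated product is known at time `t` and the new factor is independent of
    -- it; off `b t`, nothing changes.
    have hprod : ∫⁻ w, (b t).indicator Z w * ENNReal.ofReal (Real.exp (y t w)) ∂μ
        = (∫⁻ w, (b t).indicator Z w ∂μ) * ∫⁻ w, ENNReal.ofReal (Real.exp (y t w)) ∂μ := by
      have := lintegral_mul_eq_lintegral_mul_lintegral_of_independent_measurableSpace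
        (μ := μ) (f := (b t).indicator Z) (g := fun w => ENNReal.ofReal (Real.exp (y t w)))
        (ℱ.le t) (((hy t).mono (ℱ.le _) le_rfl).comap_le) (hind t).symm
        (hZm.indicator (hb t))
        ((Real.measurable_exp.comp (comap_measurable (y t))).ennreal_ofReal)
      simpa using this
    rw [hprod]
    calc _ ≤ ∫⁻ w, (b t)ᶜ.indicator Z w ∂μ + (∫⁻ w, (b t).indicator Z w ∂μ) * 1 := by
            gcongr; exact hmean t
      _ = ∫⁻ w, Z w ∂μ := by
            rw [mul_one, lintegral_indicator hbt.compl, lintegral_indicator hbt, add_comm,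
              lintegral_add_compl _ hbt]

/-- Hoeffding's inequality for the sum of the first `n` predictably selected terms. -/
theorem measure_exists_selSum_ge_le [IsProbabilityMeasure μ]
    {b : ℕ → Set Ω} (hb : ∀ m, MeasurableSet[ℱ m] (b m))
    {y : ℕ → Ω → ℝ} (hy : ∀ m, Measurable[ℱ (m + 1)] (y m))
    (hind : ∀ m, Indep (MeasurableSpace.comap (y m) inferInstance) (ℱ m) μ)
    (hsub : ∀ m, HasSubgaussianMGF (y m) (1 / 4) μ)
    (n t : ℕ) {d : ℝ} (hd : 0 ≤ d) :
    μ.real {w | ∃ s ≤ t, selCount b s w = n ∧ n * d ≤ selSum b y s w}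
      ≤ Real.exp (-(2 * n * d ^ 2)) := by
  -- Stopping after `n` selections lets one Markov bound at the fixed time `t` cover every `s ≤ t`,
  -- without a union bound. The tilt `4 * d` is optimal for variance proxy `1/4`, and `2 * d ^ 2`
  -- compensates it exactly; at the event the exponent is at least `4nd² - 2nd² = 2nd²`.
  set b' : ℕ → Set Ω := fun m => b m ∩ {w | selCount b m w < n}
  set y' : ℕ → Ω → ℝ := fun m w => 4 * d * y m w - 2 * d ^ 2
  have hb' : ∀ m, MeasurableSet[ℱ m] (b' m) := fun m =>
    (hb m).inter (measurableSet_lt (measurable_selCount hb m) measurable_const)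
  have hy' : ∀ m, Measurable[ℱ (m + 1)] (y' m) := fun m =>
    ((hy m).const_mul _).sub_const _
  have hind' : ∀ m, Indep (MeasurableSpace.comap (y' m) inferInstance) (ℱ m) μ := by
    intro m
    refine indep_of_indep_of_le_left (hind m) ?_
    refine Measurable.comap_le ?_
    exact ((comap_measurable (y m)).const_mul _).sub_const _
  have hmean : ∀ m, ∫⁻ w, ENNReal.ofReal (Real.exp (y' m w)) ∂μ ≤ 1 := by
    intro m
    have hm := (hsub m).mgf_le (4 * d)
    have e : ∀ w, Real.exp (y' m w) = Real.exp (-(2 * d ^ 2)) * Real.exp (4 * d * y m w) := by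
      intro w; rw [← Real.exp_add]; congr 1; simp only [y']; ring
    simp_rw [e]
    rw [← ofReal_integral_eq_lintegral_ofReal (((hsub m).integrable_exp_mul _).const_mul _)
      (Filter.Eventually.of_forall fun w => by positivity), integral_const_mul]
    refine ENNReal.ofReal_le_one.2 ?_
    calc _ ≤ Real.exp (-(2 * d ^ 2)) * Real.exp ((1 / 4 : NNReal) * (4 * d) ^ 2 / 2) := by
            gcongr; exact hm
      _ = 1 := by
            rw [← Real.exp_add, Real.exp_eq_one_iff]; push_cast; ring
  have key := lintegral_exp_selSum_le_one hb' hy' hind' hmean t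
  have hsel : ∀ s w, selSum b y' s w = 4 * d * selSum b y s w - 2 * d ^ 2 * selCount b s w := by
    intro s w
    induction s with
    | zero => simp [selSum, selCount]
    | succ s ih =>
      rw [selSum_succ, ih, selSum_succ, selCount_succ]
      by_cases h : w ∈ b s
      · simp [h, y']; ring
      · simp [h]
  have hsubset : {w | ∃ s ≤ t, selCount b s w = n ∧ n * d ≤ selSum b y s w}
      ⊆ {w | ENNReal.ofReal (Real.exp (2 * n * d ^ 2))
          ≤ ENNReal.ofReal (Real.exp (selSum b' y' t w))} := by
    rintro w ⟨s, hst, hn, hS⟩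
    refine ENNReal.ofReal_le_ofReal (Real.exp_le_exp.2 ?_)
    have h1 : selSum b' y' t w = selSum b y' s w := by
      rw [← selSum_stopped b y' hst w, hn]
    rw [h1, hsel, hn]
    nlinarith [mul_le_mul_of_nonneg_left hS hd]
  have hmeas : Measurable fun w => ENNReal.ofReal (Real.exp (selSum b' y' t w)) :=
    (Real.measurable_exp.comp
      ((measurable_selSum hb' hy' t).mono (ℱ.le t) le_rfl)).ennreal_ofReal
  have hmarkov := mul_meas_ge_le_lintegral₀ hmeas.aemeasurable (μ := μ)
    (ENNReal.ofReal (Real.exp (2 * n * d ^ 2)))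
  have h2 := (mul_le_mul_right (measure_mono (μ := μ) hsubset)
    (ENNReal.ofReal (Real.exp (2 * n * d ^ 2)))).trans (hmarkov.trans key)
  have h3 := ENNReal.toReal_mono ENNReal.one_ne_top h2
  rw [ENNReal.toReal_mul, ENNReal.toReal_ofReal (Real.exp_nonneg _), ENNReal.toReal_one] at h3
  rw [Real.exp_neg, ← one_div, le_div_iff₀' (Real.exp_pos _)]
  exact h3

end Hoeffding

/-! ### Two inequalities for finite sums. -/

theorem sum_sqrt_div_le {L δ : ℝ} (hL : 0 ≤ L) (hδ : 0 < δ) (m : ℕ) :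
    ∑ n ∈ Finset.range m, (if 1 ≤ n ∧ n * δ ^ 2 ≤ L then √(L / n) else 0) ≤ 2 * L / δ := by
  -- The minimum makes the induction close: a term within the cutoff has `√(m+1) ≤ √L / δ` and
  -- telescopes by `1/√(m+1) ≤ 2(√(m+1) - √m)`; later terms vanish.
  have key : ∀ m : ℕ,
      ∑ n ∈ Finset.range (m + 1), (if 1 ≤ n ∧ n * δ ^ 2 ≤ L then √(L / n) else 0)
        ≤ 2 * √L * min √m (√L / δ) := by
    intro m
    induction m with
    | zero => simp; positivity
    | succ m ih =>
      rw [Finset.sum_range_succ]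
      split_ifs with h
      · have h1 : √((m + 1 : ℕ) : ℝ) ≤ √L / δ := by
          rw [le_div_iff₀ hδ]
          have := Real.sqrt_le_sqrt h.2
          rwa [Real.sqrt_mul (by positivity), Real.sqrt_sq hδ.le] at this
        have h2 : √(m : ℝ) ≤ √((m + 1 : ℕ) : ℝ) :=
          Real.sqrt_le_sqrt (by push_cast; linarith)
        rw [min_eq_left h1]
        rw [min_eq_left (h2.trans h1)] at ih
        have h3 : 0 < √((m + 1 : ℕ) : ℝ) := Real.sqrt_pos.2 (by positivity)
        have h4 : √(L / (m + 1 : ℕ)) ≤ 2 * √L * (√((m + 1 : ℕ) : ℝ) - √(m : ℝ)) := by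
          rw [Real.sqrt_div hL, div_le_iff₀ h3]
          have e1 := Real.sq_sqrt (show (0 : ℝ) ≤ ((m + 1 : ℕ) : ℝ) by positivity)
          have e2 := Real.sq_sqrt (show (0 : ℝ) ≤ (m : ℝ) by positivity)
          have : 1 ≤ 2 * (√((m + 1 : ℕ) : ℝ) - √(m : ℝ)) * √((m + 1 : ℕ) : ℝ) := by
            push_cast at *
            nlinarith [sq_nonneg (√(m + 1 : ℝ) - √(m : ℝ))]
          nlinarith [mul_le_mul_of_nonneg_left this (Real.sqrt_nonneg L)]
        linarith
      · rw [add_zero]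
        refine ih.trans ?_
        gcongr
        simp
  have hb : 2 * √L * (√L / δ) = 2 * L / δ := by
    rw [← mul_div_assoc, mul_assoc, Real.mul_self_sqrt hL]
  cases m with
  | zero => simp; positivity
  | succ m =>
    refine (key m).trans ?_
    rw [← hb]
    gcongr
    exact min_le_right _ _

/-- Common elements cancel and the two differences have equal size, so every missing value may be
replaced by the largest one and paired with each wrongly chosen `j`. -/
theorem sum_sub_sum_le_sum_sdiff {ι : Type*} [DecidableEq ι] {S a : Finset ι}
    (hcard : S.card = a.card) {f g : ι → ℝ}
    (h : ∀ j ∈ a \ S, ∀ l ∈ S \ a, f l - f j ≤ g j) :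
    ∑ l ∈ S, f l - ∑ j ∈ a, f j ≤ ∑ j ∈ a \ S, g j := by
  have hc : (S \ a).card = (a \ S).card := Finset.card_sdiff_comm hcard
  rw [← Finset.sum_sdiff_sub_sum_sdiff]
  rcases (S \ a).eq_empty_or_nonempty with he | hne
  · have : a \ S = ∅ := by rw [← Finset.card_eq_zero, ← hc, he, Finset.card_empty]
    simp [he, this]
  · obtain ⟨l, hl, hmax⟩ := Finset.exists_max_image (S \ a) f hne
    calc ∑ l ∈ S \ a, f l - ∑ j ∈ a \ S, f j
        ≤ ∑ j ∈ a \ S, f l - ∑ j ∈ a \ S, f j := by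
          rw [Finset.sum_const, ← hc, ← Finset.sum_const]
          gcongr with x hx
          exact hmax x hx
      _ = ∑ j ∈ a \ S, (f l - f j) := by rw [Finset.sum_sub_distrib]
      _ ≤ _ := Finset.sum_le_sum fun j hj => h j hj l hl

/-! ### Means and gaps. -/

namespace DiverseModel

variable {M N G K : ℕ} (P : DiverseModel M N G K)

theorem mean_mem_Icc (i : Fin M) (j : Fin N) : P.mean i j ∈ Set.Icc (0 : ℝ) 1 := by
  have := P.law_prob i j
  have hs := P.law_support i j
  have hint : Integrable (fun x : ℝ => x) (P.law i j) :=
    Integrable.of_mem_Icc 0 1 measurable_id.aemeasurable hs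
  constructor
  · exact integral_nonneg_of_ae (hs.mono fun x hx => hx.1)
  · have := integral_mono_ae hint (integrable_const (1 : ℝ)) (hs.mono fun x hx => hx.2)
    simpa [mean] using this

theorem kthMean_le (i : Fin M) {l : Fin N} (hl : l ∈ P.topSet i) : P.kthMean i ≤ P.mean i l :=
  Finset.inf'_le _ hl

theorem gap_le (i : Fin M) {l : Fin N} (hl : l ∈ P.topSet i) (j : Fin N) :
    P.gap i j ≤ P.mean i l - P.mean i j :=
  sub_le_sub_right (P.kthMean_le i hl) _

theorem gap_pos (i : Fin M) {j : Fin N} (hj : j ∉ P.topSet i) : 0 < P.gap i j := by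
  rw [gap, sub_pos, kthMean, Finset.lt_inf'_iff]
  intro l hl
  refine lt_of_le_of_ne ((P.pref_top i).2 l hl j hj) fun h => ?_
  exact hj (P.mean_injective i h ▸ hl)

end DiverseModel

/-! ### Comparison of indices. -/

namespace Trajectory

variable {M N G K : ℕ} {τ : Trajectory M N G} {P : DiverseModel M N G K} {α : ℝ}
  {disc : Fin M → Fin M → ℕ → ℝ}

/-- Powers of counts are nonnegative for every real exponent, and a zero denominator gives the value
`0`. Nothing else about the group estimates enters the regret bound. -/
theorem groupFreq_mem_Icc (τ : Trajectory M N G) (P : DiverseModel M N G K)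
    (disc : Fin M → Fin M → ℕ → ℝ) (i : Fin M) (j : Fin N) (t : ℕ) :
    τ.groupFreq P disc i j t ∈ Set.Icc (0 : ℝ) 1 := by
  have h0 : ∀ m : Fin N, 0 ≤ ∑ k : Fin M, (τ.count k m t : ℝ) ^ τ.exponent P disc i k t :=
    fun m => Finset.sum_nonneg fun k _ => by positivity
  refine ⟨div_nonneg (h0 j) (Finset.sum_nonneg fun m _ => h0 m), ?_⟩
  exact div_le_one_of_le₀ (Finset.single_le_sum (fun m _ => h0 m) (Finset.mem_univ j))
    (Finset.sum_nonneg fun m _ => h0 m)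

/-- If a tried option is preferred to another one, then the latter has been tried as well, and
the upper confidence bounds are ordered up to the discount term. -/
theorem FollowsDPart.ucb_le (h : τ.FollowsDPart P α disc) {i : Fin M} {s : ℕ} {j l : Fin N}
    (hj : j ∈ τ.choice i (s + 1)) (hl : l ∉ τ.choice i (s + 1)) (hc : τ.count i j s ≠ 0) :
    τ.count i l s ≠ 0 ∧
      τ.sampleMean i l s + √(2 * Real.log s / τ.count i l s)
        ≤ τ.sampleMean i j s + √(2 * Real.log s / τ.count i j s)
          + |α| * √(Real.log s / s) := by
  have hle := (h.choice_top i s).2 j hj l hl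
  simp only [index, if_neg hc] at hle
  have hcl : τ.count i l s ≠ 0 := by
    intro h0
    rw [if_pos h0] at hle
    exact EReal.coe_ne_top _ (top_le_iff.1 hle)
  refine ⟨hcl, ?_⟩
  rw [if_neg hcl, EReal.coe_le_coe_iff] at hle
  have bl := τ.groupFreq_mem_Icc P disc i l s
  have bj := τ.groupFreq_mem_Icc P disc i j s
  -- The discount terms of `j` and `l` differ by this factor times `√(log s / s)`.
  have habs : α * (τ.groupFreq P disc i j s - τ.groupFreq P disc i l s) ≤ |α| := by
    refine (le_abs_self _).trans ?_
    rw [abs_mul]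
    refine mul_le_of_le_one_right (abs_nonneg _) (abs_le.2 ⟨?_, ?_⟩)
    · linarith [bl.2, bj.1]
    · linarith [bj.2, bl.1]
  nlinarith [mul_le_mul_of_nonneg_right habs (Real.sqrt_nonneg (Real.log s / s))]

end Trajectory

/-! ### Rewards, sample means and regret of the process. -/

namespace DPartProcess

variable {M N G K : ℕ} {P : DiverseModel M N G K} {α : ℝ} {disc : Fin M → Fin M → ℕ → ℝ}
  {Ω : Type*} [mΩ : MeasurableSpace Ω] {μ : Measure Ω} (A : DPartProcess P α disc μ)

/-- The event that user `i` selects option `j` in round `m + 1`. -/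
def sel (i : Fin M) (j : Fin N) (m : ℕ) : Set Ω := {w | j ∈ (A.traj w).choice i (m + 1)}

/-- The deviation from its mean of the reward of user `i` from option `j` in round `m + 1`. -/
noncomputable def dev (i : Fin M) (j : Fin N) (m : ℕ) (w : Ω) : ℝ :=
  (A.traj w).reward i j (m + 1) - P.mean i j

theorem measurableSet_sel (i : Fin M) (j : Fin N) (m : ℕ) : MeasurableSet[A.ℱ m] (A.sel i j m) :=
  A.choice_measurable i j m

theorem measurable_dev (i : Fin M) (j : Fin N) (m : ℕ) :
    Measurable[A.ℱ (m + 1)] (A.dev i j m) :=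
  (A.reward_measurable i j m).sub_const _

theorem indep_dev (i : Fin M) (j : Fin N) (m : ℕ) :
    Indep (MeasurableSpace.comap (A.dev i j m) inferInstance) (A.ℱ m) μ := by
  refine indep_of_indep_of_le_left (A.reward_indep i j m) (Measurable.comap_le ?_)
  exact (comap_measurable fun w => (A.traj w).reward i j (m + 1)).sub_const _

theorem measurable_reward (i : Fin M) (j : Fin N) (m : ℕ) :
    Measurable fun w => (A.traj w).reward i j (m + 1) :=
  (A.reward_measurable i j m).mono (A.ℱ.le _) le_rfl

theorem reward_mem_Icc (i : Fin M) (j : Fin N) (m : ℕ) :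
    ∀ᵐ w ∂μ, (A.traj w).reward i j (m + 1) ∈ Set.Icc (0 : ℝ) 1 := by
  have h := P.law_support i j
  rw [← A.reward_law i j m] at h
  exact ae_of_ae_map (A.measurable_reward i j m).aemeasurable h

theorem integral_reward (i : Fin M) (j : Fin N) (m : ℕ) :
    ∫ w, (A.traj w).reward i j (m + 1) ∂μ = P.mean i j := by
  rw [DiverseModel.mean, ← A.reward_law i j m]
  exact (integral_map (A.measurable_reward i j m).aemeasurable aestronglyMeasurable_id).symm

theorem hasSubgaussianMGF_dev [IsProbabilityMeasure μ] (i : Fin M) (j : Fin N) (m : ℕ) :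
    HasSubgaussianMGF (A.dev i j m) (1 / 4) μ := by
  have h := hasSubgaussianMGF_of_mem_Icc (A.measurable_reward i j m).aemeasurable
    (A.reward_mem_Icc i j m)
  rw [A.integral_reward] at h
  have hc : (1 / 4 : NNReal) = (‖(1 : ℝ) - 0‖₊ / 2) ^ 2 := by
    ext
    norm_num
  rw [hc]
  exact h

theorem count_eq (i : Fin M) (j : Fin N) (t : ℕ) (w : Ω) :
    (A.traj w).count i j t = selCount (A.sel i j) t w := by
  induction t with
  | zero => simp [Trajectory.count, selCount]
  | succ t ih =>
    rw [selCount_succ, ← ih]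
    unfold Trajectory.count
    rw [← Finset.insert_Icc_right_eq_Icc_add_one (by omega : 1 ≤ t + 1), Finset.filter_insert]
    by_cases h : j ∈ (A.traj w).choice i (t + 1)
    · simp [h, sel]
    · simp [h, sel]

/-- Connects sample means with the sums in Hoeffding's inequality. The product form also covers
untried options, where both sides are `0`. -/
theorem count_mul_sampleMean (i : Fin M) (j : Fin N) (t : ℕ) (w : Ω) :
    (A.traj w).count i j t * ((A.traj w).sampleMean i j t - P.mean i j)
      = selSum (A.sel i j) (A.dev i j) t w := by
  have hsum : selSum (A.sel i j) (A.dev i j) t w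
      = (∑ m ∈ Finset.Icc 1 t,
          if j ∈ (A.traj w).choice i m then (A.traj w).reward i j m else 0)
        - (A.traj w).count i j t * P.mean i j := by
    rw [count_eq]
    induction t with
    | zero => simp [selSum, selCount]
    | succ t ih =>
      rw [selSum_succ, selCount_succ, ih, Finset.sum_Icc_succ_top (by omega)]
      by_cases h : j ∈ (A.traj w).choice i (t + 1)
      · simp [h, sel, dev]; ring
      · simp [h, sel]
  rw [hsum, mul_sub]
  congr 1
  rcases eq_or_ne ((A.traj w).count i j t) 0 with h0 | h0
  · rw [h0]
    rw [Nat.cast_zero, zero_mul, eq_comm]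
    refine Finset.sum_eq_zero fun m hm => if_neg fun hjm => ?_
    exact (Finset.filter_eq_empty_iff.1 (Finset.card_eq_zero.1 h0)) hm hjm
  · rw [Trajectory.sampleMean, mul_div_cancel₀ _ (Nat.cast_ne_zero.2 h0)]

/-- The selection is decided before the round, and given that past the reward has constant
conditional mean. -/
theorem integral_indicator_reward [IsProbabilityMeasure μ] (i : Fin M) (j : Fin N) (m : ℕ) :
    ∫ w, (A.sel i j m).indicator (fun w => (A.traj w).reward i j (m + 1)) w ∂μ
      = ∫ w, (A.sel i j m).indicator (fun _ => P.mean i j) w ∂μ := by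
  have hb := A.ℱ.le m _ (A.measurableSet_sel i j m)
  have hint : Integrable (fun w => (A.traj w).reward i j (m + 1)) μ :=
    Integrable.of_mem_Icc 0 1 (A.measurable_reward i j m).aemeasurable (A.reward_mem_Icc i j m)
  have hce := condExp_indep_eq (A.measurable_reward i j m).comap_le (A.ℱ.le m)
    (comap_measurable fun w => (A.traj w).reward i j (m + 1)).stronglyMeasurable
    (A.reward_indep i j m)
  rw [A.integral_reward] at hce
  rw [integral_indicator hb, integral_indicator hb,
    ← setIntegral_condExp (A.ℱ.le m) hint (A.measurableSet_sel i j m)]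
  exact setIntegral_congr_ae hb (hce.mono fun w hw _ => hw)

theorem integrable_sum_choice [IsProbabilityMeasure μ] (i : Fin M) (m : ℕ) :
    Integrable (fun w => ∑ j ∈ (A.traj w).choice i (m + 1), P.mean i j) μ := by
  have e : ∀ w, ∑ j ∈ (A.traj w).choice i (m + 1), P.mean i j
      = ∑ j, (A.sel i j m).indicator (fun _ => P.mean i j) w := by
    intro w
    simp only [Set.indicator_apply, sel, Set.mem_ofPred_eq]
    rw [← Finset.sum_filter, Finset.filter_univ_mem]
  simp_rw [e]
  exact integrable_finsetSum _ fun j _ =>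
    (integrable_const _).indicator (A.ℱ.le m _ (A.measurableSet_sel i j m))

/-- The weak regret is the expected sum of the losses in mean of the rounds. -/
theorem weakRegret_eq [IsProbabilityMeasure μ] (i : Fin M) (T : ℕ) :
    A.weakRegret i T = ∫ w, ∑ s ∈ Finset.range T,
      (∑ j ∈ P.topSet i, P.mean i j - ∑ j ∈ (A.traj w).choice i (s + 1), P.mean i j) ∂μ := by
  have hb := fun j m => A.ℱ.le m _ (A.measurableSet_sel i j m)
  have e : ∀ (f : ℕ → Fin N → Ω → ℝ) (s : ℕ) (w : Ω),
      ∑ j ∈ (A.traj w).choice i (s + 1), f s j w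
        = ∑ j, (A.sel i j s).indicator (f s j) w := by
    intro f s w
    simp only [Set.indicator_apply, sel, Set.mem_ofPred_eq]
    rw [← Finset.sum_filter, Finset.filter_univ_mem]
  have h1 : ∫ w, ∑ t ∈ Finset.Icc 1 T, ∑ j ∈ (A.traj w).choice i t, (A.traj w).reward i j t ∂μ
      = ∑ s ∈ Finset.range T, ∫ w, ∑ j ∈ (A.traj w).choice i (s + 1), P.mean i j ∂μ := by
    have h2 : ∀ w, ∑ t ∈ Finset.Icc 1 T,
        ∑ j ∈ (A.traj w).choice i t, (A.traj w).reward i j t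
        = ∑ s ∈ Finset.range T, ∑ j, (A.sel i j s).indicator
            (fun w => (A.traj w).reward i j (s + 1)) w := by
      intro w
      rw [Finset.range_eq_Ico, ← Finset.Ico_add_one_right_eq_Icc]
      rw [← Finset.sum_Ico_add' _ 0 T 1]
      exact Finset.sum_congr rfl fun s _ =>
        e (fun s j w => (A.traj w).reward i j (s + 1)) s w
    have hint : ∀ s j, Integrable
        ((A.sel i j s).indicator fun w => (A.traj w).reward i j (s + 1)) μ := fun s j =>
      (Integrable.of_mem_Icc 0 1 (A.measurable_reward i j s).aemeasurable
        (A.reward_mem_Icc i j s)).indicator (hb j s)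
    simp_rw [h2]
    rw [integral_finsetSum _ fun s _ => integrable_finsetSum _ fun j _ => hint s j]
    refine Finset.sum_congr rfl fun s _ => ?_
    rw [integral_finsetSum _ fun j _ => hint s j]
    simp_rw [fun w => e (fun _ j _ => P.mean i j) s w]
    rw [integral_finsetSum _ fun j _ => (integrable_const _).indicator (hb j s)]
    exact Finset.sum_congr rfl fun j _ => A.integral_indicator_reward i j s
  rw [weakRegret, h1, integral_finsetSum (f := fun s w => ∑ j ∈ P.topSet i, P.mean i j
    - ∑ j ∈ (A.traj w).choice i (s + 1), P.mean i j) _ fun s _ =>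
      (integrable_const _).sub (A.integrable_sum_choice i s)]
  simp_rw [fun s => integral_sub (integrable_const (∑ j ∈ P.topSet i, P.mean i j))
    (A.integrable_sum_choice i s)]
  simp [Finset.sum_sub_distrib]

/-! ### Deviation events and their probabilities. -/

/-- The event that, after `n` selections of option `j` and at most `t` rounds, the sample mean
exceeds the mean by at least `gap / 20`. -/
def overestimated (i : Fin M) (j : Fin N) (t n : ℕ) : Set Ω :=
  {w | ∃ s ≤ t, selCount (A.sel i j) s w = n ∧
    n * (P.gap i j / 20) ≤ selSum (A.sel i j) (A.dev i j) s w}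

/-- The event that after `s` rounds the mean of option `l` is at least its upper confidence
bound. -/
def underestimated (i : Fin M) (l : Fin N) (s : ℕ) : Set Ω :=
  ⋃ n ∈ Finset.Icc 1 s, {w | ∃ s' ≤ s, selCount (A.sel i l) s' w = n ∧
    n * √(2 * Real.log s / n) ≤ selSum (A.sel i l) (fun m w => -A.dev i l m w) s' w}

theorem measurableSet_exists_selSum_ge {b : ℕ → Set Ω} {ℱ : Filtration ℕ mΩ}
    (hb : ∀ m, MeasurableSet[ℱ m] (b m)) {y : ℕ → Ω → ℝ} (hy : ∀ m, Measurable[ℱ (m + 1)] (y m))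
    (n t : ℕ) (c : ℝ) :
    MeasurableSet {w | ∃ s ≤ t, selCount b s w = n ∧ c ≤ selSum b y s w} := by
  have e : {w | ∃ s ≤ t, selCount b s w = n ∧ c ≤ selSum b y s w}
      = ⋃ s ∈ Finset.range (t + 1), ({w | selCount b s w = n} ∩ {w | c ≤ selSum b y s w}) := by
    ext w
    simp [and_left_comm]
  rw [e]
  refine Finset.measurableSet_biUnion _ fun s _ => MeasurableSet.inter ?_ ?_
  · exact (measurable_selCount hb s).mono (ℱ.le s) le_rfl (measurableSet_singleton n)
  · exact measurableSet_le measurable_const ((measurable_selSum hb hy s).mono (ℱ.le s) le_rfl)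

theorem measurableSet_overestimated (i : Fin M) (j : Fin N) (t n : ℕ) :
    MeasurableSet (A.overestimated i j t n) :=
  measurableSet_exists_selSum_ge (A.measurableSet_sel i j) (A.measurable_dev i j) n t _

theorem measurableSet_underestimated (i : Fin M) (l : Fin N) (s : ℕ) :
    MeasurableSet (A.underestimated i l s) :=
  Finset.measurableSet_biUnion _ fun n _ =>
    measurableSet_exists_selSum_ge (A.measurableSet_sel i l)
      (fun m => (A.measurable_dev i l m).neg) n s _

theorem measureReal_overestimated_le [IsProbabilityMeasure μ] (i : Fin M) {j : Fin N}
    (hj : j ∉ P.topSet i) (t n : ℕ) :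
    μ.real (A.overestimated i j t n) ≤ Real.exp (n * -(2 * (P.gap i j / 20) ^ 2)) := by
  have h := measure_exists_selSum_ge_le (A.measurableSet_sel i j) (A.measurable_dev i j)
    (A.indep_dev i j) (A.hasSubgaussianMGF_dev i j) n t
    (div_nonneg (P.gap_pos i hj).le (by norm_num : (0 : ℝ) ≤ 20))
  refine h.trans_eq ?_
  congr 1
  ring

/-- For each `n`, the confidence radius turns Hoeffding's exponent into `4 log s`; a union over the
`s` possible counts costs a factor `s`. -/
theorem measureReal_underestimated_le [IsProbabilityMeasure μ] (i : Fin M) (l : Fin N) (s : ℕ) :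
    μ.real (A.underestimated i l s) ≤ ((s : ℝ) ^ 3)⁻¹ := by
  have hb : ∀ n ∈ Finset.Icc 1 s, μ.real {w | ∃ s' ≤ s, selCount (A.sel i l) s' w = n ∧
      n * √(2 * Real.log s / n) ≤ selSum (A.sel i l) (fun m w => -A.dev i l m w) s' w}
      ≤ ((s : ℝ) ^ 4)⁻¹ := by
    intro n hn
    obtain ⟨h1, h2⟩ := Finset.mem_Icc.1 hn
    have hind : ∀ m, Indep
        (MeasurableSpace.comap (fun w => -A.dev i l m w) inferInstance) (A.ℱ m) μ := fun m =>
      indep_of_indep_of_le_left (A.indep_dev i l m)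
        (Measurable.comap_le (comap_measurable (A.dev i l m)).neg)
    have h := measure_exists_selSum_ge_le (A.measurableSet_sel i l)
      (fun m => (A.measurable_dev i l m).neg) hind
      (fun m => (A.hasSubgaussianMGF_dev i l m).neg) n s (Real.sqrt_nonneg (2 * Real.log s / n))
    refine h.trans_eq ?_
    have hn0 : (0 : ℝ) < n := by exact_mod_cast h1
    have hs1 : (1 : ℝ) ≤ s := by exact_mod_cast h1.trans h2
    rw [Real.sq_sqrt (div_nonneg (mul_nonneg zero_le_two (Real.log_nonneg hs1)) hn0.le),
      Real.exp_neg]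
    congr 1
    rw [show 2 * (n : ℝ) * (2 * Real.log s / n) = (4 : ℕ) * Real.log s by
      push_cast; field_simp; ring, Real.exp_nat_mul, Real.exp_log (by linarith)]
  refine (measureReal_biUnion_finset_le _ _).trans ((Finset.sum_le_sum hb).trans_eq ?_)
  rcases Nat.eq_zero_or_pos s with rfl | hs
  · simp
  · have : (0 : ℝ) < s := by exact_mod_cast hs
    rw [Finset.sum_const, Nat.card_Icc, nsmul_eq_mul]
    simp only [Nat.add_sub_cancel]
    field_simp

/-! ### Pathwise bound on the loss. -/

/-- The loss caused by a selected inferior option in place of a better one. -/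
theorem mean_sub_mean_le (i : Fin M) {s₀ : ℕ} (hs₀ : 1 ≤ s₀)
    (hα : ∀ s ≥ s₀, ∀ j ∈ (P.topSet i)ᶜ, |α| * √(Real.log s / s) ≤ P.gap i j / 20)
    {s t : ℕ} (hst : s ≤ t) (w : Ω) {j l : Fin N} (hjT : j ∉ P.topSet i) (hlT : l ∈ P.topSet i)
    (hj : j ∈ (A.traj w).choice i (s + 1)) (hl : l ∉ (A.traj w).choice i (s + 1)) :
    P.mean i l - P.mean i j ≤
      ((fun n : ℕ => (if 1 ≤ n ∧ n * P.gap i j ^ 2 ≤ 3 * Real.log t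
          then √(3 * Real.log t / n) else 0)
          + (if n = 0 then 1 else 0) + (A.overestimated i j t n).indicator 1 w)
        (selCount (A.sel i j) s w))
      + ((if s < s₀ then 1 else 0)
        + ∑ l ∈ P.topSet i, (A.underestimated i l s).indicator 1 w) := by
  have hle1 : P.mean i l - P.mean i j ≤ 1 := by
    linarith [(P.mean_mem_Icc i l).2, (P.mean_mem_Icc i j).1]
  set c := selCount (A.sel i j) s w with hc
  have hnon : ∀ n : ℕ, (0 : ℝ) ≤ if 1 ≤ n ∧ n * P.gap i j ^ 2 ≤ 3 * Real.log t
      then √(3 * Real.log t / n) else 0 := fun n => by split_ifs <;> positivity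
  have hnon0 : (0 : ℝ) ≤ if c = 0 then 1 else 0 := by split_ifs <;> norm_num
  have hnon1 : (0 : ℝ) ≤ (A.overestimated i j t c).indicator 1 w :=
    Set.indicator_nonneg (fun _ _ => zero_le_one) _
  have hnon2 : (0 : ℝ) ≤ if s < s₀ then 1 else 0 := by split_ifs <;> norm_num
  have hnon3 : ∀ l ∈ P.topSet i, (0 : ℝ) ≤ (A.underestimated i l s).indicator 1 w :=
    fun _ _ => Set.indicator_nonneg (fun _ _ => zero_le_one) _
  have hnon4 := Finset.sum_nonneg hnon3
  have hnonc := hnon c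
  beta_reduce
  -- Each exceptional case contributes a term `1` on the right, which suffices because means lie in
  -- `[0, 1]`.
  by_cases h1 : c = 0
  · rw [if_pos h1]; linarith
  by_cases h2 : s < s₀
  · rw [if_pos h2]; linarith
  by_cases h3 : w ∈ A.overestimated i j t c
  · rw [Set.indicator_of_mem h3, Pi.one_apply]; linarith
  by_cases h4 : w ∈ A.underestimated i l s
  · have := Finset.single_le_sum hnon3 hlT
    rw [Set.indicator_of_mem h4, Pi.one_apply] at this
    linarith
  push Not at h2
  have hs1 : (1 : ℝ) ≤ s := by exact_mod_cast hs₀.trans h2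
  have hst' : (s : ℝ) ≤ t := by exact_mod_cast hst
  have hlog0 : 0 ≤ Real.log s := Real.log_nonneg hs1
  have hlog : Real.log s ≤ Real.log t := Real.log_le_log (by linarith) hst'
  have hcj : (A.traj w).count i j s ≠ 0 := by rwa [A.count_eq]
  obtain ⟨hcl, hucb⟩ := (A.follows w).ucb_le hj hl hcj
  have hc0 : (0 : ℝ) < c := by exact_mod_cast Nat.pos_of_ne_zero h1
  have hover : (A.traj w).sampleMean i j s < P.mean i j + P.gap i j / 20 := by
    by_contra hcon
    push Not at hcon
    refine h3 ⟨s, hst, rfl, ?_⟩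
    rw [← A.count_mul_sampleMean, A.count_eq, ← hc]
    exact mul_le_mul_of_nonneg_left (by linarith) hc0.le
  have hunder : P.mean i l <
      (A.traj w).sampleMean i l s + √(2 * Real.log s / (A.traj w).count i l s) := by
    by_contra hcon
    push Not at hcon
    refine h4 (Set.mem_biUnion (x := (A.traj w).count i l s) ?_ ⟨s, le_rfl, ?_, ?_⟩)
    · rw [A.count_eq] at hcl ⊢
      exact Finset.mem_coe.2 (Finset.mem_Icc.2 ⟨Nat.pos_of_ne_zero hcl, selCount_le _ _ _⟩)
    · rw [A.count_eq]
    · have hneg : selSum (A.sel i l) (fun m w => -A.dev i l m w) s w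
          = -selSum (A.sel i l) (A.dev i l) s w := by
        unfold selSum
        rw [← Finset.sum_neg_distrib]
        refine Finset.sum_congr rfl fun m _ => ?_
        by_cases hm : w ∈ A.sel i l m <;> simp [hm]
      rw [hneg, ← A.count_mul_sampleMean, ← mul_neg]
      exact mul_le_mul_of_nonneg_left (by linarith) (Nat.cast_nonneg _)
  have hgap := P.gap_le i hlT j
  have hpos := P.gap_pos i hjT
  have hα' := hα s h2 j (Finset.mem_compl.2 hjT)
  rw [A.count_eq i j, ← hc] at hucb
  -- The overestimate and the discount term cost a twentieth of the gap each, hence at most a tenth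
  -- of the difference of means. Then `2 / 0.81 < 3` gives the constant `3`.
  have hD : 9 / 10 * (P.mean i l - P.mean i j) ≤ √(2 * Real.log s / c) := by linarith
  have hD2 := pow_le_pow_left₀ (by linarith : 0 ≤ 9 / 10 * (P.mean i l - P.mean i j)) hD 2
  rw [Real.sq_sqrt (by positivity), le_div_iff₀ hc0] at hD2
  have hD3 : (P.mean i l - P.mean i j) ^ 2 * c ≤ 3 * Real.log t := by nlinarith
  have hgap2 : c * P.gap i j ^ 2 ≤ 3 * Real.log t := by
    have := pow_le_pow_left₀ hpos.le hgap 2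
    nlinarith
  rw [if_pos ⟨Nat.pos_of_ne_zero h1, hgap2⟩]
  have : P.mean i l - P.mean i j ≤ √(3 * Real.log t / c) :=
    Real.le_sqrt_of_sq_le ((le_div_iff₀ hc0).2 hD3)
  linarith

/-- The total loss in mean of a realization. -/
theorem sum_loss_le (i : Fin M) {s₀ : ℕ} (hs₀ : 1 ≤ s₀)
    (hα : ∀ s ≥ s₀, ∀ j ∈ (P.topSet i)ᶜ, |α| * √(Real.log s / s) ≤ P.gap i j / 20)
    {t : ℕ} (ht : 1 ≤ t) (w : Ω) :
    ∑ s ∈ Finset.range t,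
      (∑ j ∈ P.topSet i, P.mean i j - ∑ j ∈ (A.traj w).choice i (s + 1), P.mean i j)
    ≤ ∑ j ∈ (P.topSet i)ᶜ, (6 * Real.log t / P.gap i j + 1
        + ∑ n ∈ Finset.range t, (A.overestimated i j t n).indicator 1 w
        + (s₀ + ∑ s ∈ Finset.range t, ∑ l ∈ P.topSet i,
            (A.underestimated i l s).indicator 1 w)) := by
  set f : Fin N → ℕ → ℝ := fun j n => (if 1 ≤ n ∧ n * P.gap i j ^ 2 ≤ 3 * Real.log t
          then √(3 * Real.log t / n) else 0)
          + (if n = 0 then 1 else 0) + (A.overestimated i j t n).indicator 1 w with hf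
  set e : ℕ → ℝ := fun s => (if s < s₀ then 1 else 0)
        + ∑ l ∈ P.topSet i, (A.underestimated i l s).indicator 1 w with he
  have he0 : ∀ s, 0 ≤ e s := fun s => add_nonneg (by split_ifs <;> norm_num)
    (Finset.sum_nonneg fun _ _ => Set.indicator_nonneg (fun _ _ => zero_le_one) _)
  have hlog : 0 ≤ Real.log t := Real.log_nonneg (by exact_mod_cast ht)
  have hround : ∀ s ∈ Finset.range t,
      ∑ j ∈ P.topSet i, P.mean i j - ∑ j ∈ (A.traj w).choice i (s + 1), P.mean i j
        ≤ ∑ j ∈ (P.topSet i)ᶜ,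
          ((A.sel i j s).indicator (fun _ => f j (selCount (A.sel i j) s w)) w + e s) := by
    intro s hs
    have hcard : (P.topSet i).card = ((A.traj w).choice i (s + 1)).card :=
      (P.pref_card _).trans ((A.follows w).choice_top i s).1.symm
    refine (sum_sub_sum_le_sum_sdiff (g := fun j => f j (selCount (A.sel i j) s w) + e s)
      hcard fun j hj l hl => ?_).trans ?_
    · rw [Finset.mem_sdiff] at hj hl
      exact A.mean_sub_mean_le i hs₀ hα (Finset.mem_range.1 hs).le w hj.2 hl.1 hj.1 hl.2
    · have hsdiff : (A.traj w).choice i (s + 1) \ P.topSet i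
          = (P.topSet i)ᶜ.filter (· ∈ (A.traj w).choice i (s + 1)) := by
        ext j
        simp [and_comm]
      rw [hsdiff, Finset.sum_filter]
      refine Finset.sum_le_sum fun j _ => ?_
      by_cases h : j ∈ (A.traj w).choice i (s + 1)
      · simp [h, sel]
      · simp [h, sel, he0]
  refine (Finset.sum_le_sum hround).trans ?_
  rw [Finset.sum_comm]
  refine Finset.sum_le_sum fun j hj => ?_
  -- Each selection of `j` raises its count by one, so each value of the count is charged at most
  -- once.
  rw [Finset.sum_add_distrib, sum_indicator_selCount]
  refine add_le_add ?_ ?_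
  · rw [hf]
    simp only [Finset.sum_add_distrib]
    refine add_le_add (add_le_add ?_ ?_) ?_
    · refine (sum_sqrt_div_le (by positivity) (P.gap_pos i (Finset.mem_compl.1 hj)) _).trans_eq ?_
      ring
    · rw [Finset.sum_ite_eq']
      split_ifs <;> norm_num
    -- The random number of selections is replaced by `t`, so that expectations can be taken
    -- termwise.
    · exact Finset.sum_le_sum_of_subset_of_nonneg (Finset.range_mono (selCount_le _ _ _))
        fun _ _ _ => Set.indicator_nonneg (fun _ _ => zero_le_one) _
  · rw [he]
    simp only [Finset.sum_add_distrib]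
    refine add_le_add_left ?_ _
    rw [← Finset.sum_filter, Finset.sum_const, nsmul_eq_mul, mul_one, Nat.cast_le]
    calc _ ≤ (Finset.range s₀).card := Finset.card_le_card fun s hs =>
            Finset.mem_range.2 (Finset.mem_filter.1 hs).2
      _ = s₀ := Finset.card_range _

end DPartProcess

/-! ### Expectations and the final bound. -/

theorem exists_forall_mul_sqrt_log_div_le {ι : Type*} (S : Finset ι) (a : ℝ) {g : ι → ℝ}
    (hg : ∀ j ∈ S, 0 < g j) :
    ∃ s₀ : ℕ, 1 ≤ s₀ ∧ ∀ s : ℕ, s ≥ s₀ → ∀ j ∈ S, a * √(Real.log s / s) ≤ g j := by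
  have hlim : Filter.Tendsto (fun s : ℕ => a * √(Real.log s / s)) Filter.atTop (nhds 0) := by
    have h1 : Filter.Tendsto (fun s : ℕ => Real.log s / s) Filter.atTop (nhds 0) :=
      (Real.isLittleO_log_id_atTop.tendsto_div_nhds_zero).comp tendsto_natCast_atTop_atTop
    simpa using (h1.sqrt).const_mul a
  have hev : ∀ᶠ s : ℕ in Filter.atTop, ∀ j ∈ S, a * √(Real.log s / s) ≤ g j :=
    (Filter.eventually_all_finset S).2 fun j hj => hlim.eventually_le_const (hg j hj)
  obtain ⟨s₁, h⟩ := Filter.eventually_atTop.1 hev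
  exact ⟨max 1 s₁, le_max_left _ _, fun s hs => h s ((le_max_right _ _).trans hs)⟩

theorem mainTheorem5 {M N G K : ℕ} (P : DiverseModel M N G K) (α : ℝ)
    (disc : Fin M → Fin M → ℕ → ℝ) (hdisc : ∀ i k d, disc i k d < 1)
    (i : Fin M) (ε : ℝ) (hε : 0 < ε) :
    ∃ C : ℝ, ∀ (Ω : Type*) [MeasurableSpace Ω] (μ : Measure Ω) [IsProbabilityMeasure μ]
      (A : DPartProcess P α disc μ) (t : ℕ), 1 ≤ t →
        A.weakRegret i t ≤
          (∑ j ∈ (P.topSet i)ᶜ, (⌈(6 + ε) * Real.log t / P.gap i j⌉ : ℝ)) + C := by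
  obtain ⟨s₀, hs₀, hα⟩ := exists_forall_mul_sqrt_log_div_le (P.topSet i)ᶜ |α|
    (g := fun j => P.gap i j / 20)
    fun j hj => div_pos (P.gap_pos i (Finset.mem_compl.1 hj)) (by norm_num)
  have hsum1 : ∀ j ∈ (P.topSet i)ᶜ,
      Summable fun n : ℕ => Real.exp (n * -(2 * (P.gap i j / 20) ^ 2)) := fun j hj => by
    have := P.gap_pos i (Finset.mem_compl.1 hj)
    exact Real.summable_exp_nat_mul_iff.2 (by simp only [Left.neg_neg_iff]; positivity)
  have hsum2 : Summable fun s : ℕ => ((s : ℝ) ^ 3)⁻¹ :=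
    Real.summable_nat_pow_inv.2 (by norm_num)
  -- For each inferior option: its first selection, its overestimates, the first `s₀` rounds, and
  -- the underestimates of the `K` top options. The constant is fixed before the probability space
  -- and the process, hence is independent of tie-breaking.
  refine ⟨∑ j ∈ (P.topSet i)ᶜ, (1 + (∑' n : ℕ, Real.exp (n * -(2 * (P.gap i j / 20) ^ 2)))
    + (s₀ + (P.topSet i).card * ∑' s : ℕ, ((s : ℝ) ^ 3)⁻¹)), ?_⟩
  intro Ω _ μ _ A t ht
  have hlog : 0 ≤ Real.log t := Real.log_nonneg (by exact_mod_cast ht)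
  have hi1 : ∀ j n, Integrable ((A.overestimated i j t n).indicator (1 : Ω → ℝ)) μ :=
    fun j n => (integrable_const (1 : ℝ)).indicator (A.measurableSet_overestimated i j t n)
  have hi2 : ∀ l s, Integrable ((A.underestimated i l s).indicator (1 : Ω → ℝ)) μ :=
    fun l s => (integrable_const (1 : ℝ)).indicator (A.measurableSet_underestimated i l s)
  have hI1 : ∀ j, Integrable
      (fun w => ∑ n ∈ Finset.range t, (A.overestimated i j t n).indicator (1 : Ω → ℝ) w) μ :=
    fun j => integrable_finsetSum _ fun n _ => hi1 j n
  have hI2 : Integrable (fun w => ∑ s ∈ Finset.range t, ∑ l ∈ P.topSet i,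
      (A.underestimated i l s).indicator (1 : Ω → ℝ) w) μ :=
    integrable_finsetSum _ fun s _ => integrable_finsetSum _ fun l _ => hi2 l s
  have hI : ∀ j, Integrable (fun w => 6 * Real.log t / P.gap i j + 1
        + ∑ n ∈ Finset.range t, (A.overestimated i j t n).indicator (1 : Ω → ℝ) w
        + (s₀ + ∑ s ∈ Finset.range t, ∑ l ∈ P.topSet i,
            (A.underestimated i l s).indicator (1 : Ω → ℝ) w)) μ := fun j =>
    ((integrable_const _).add (hI1 j)).add ((integrable_const _).add hI2)
  rw [A.weakRegret_eq]
  refine (integral_mono (integrable_finsetSum _ fun s _ =>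
    (integrable_const _).sub (A.integrable_sum_choice i s))
    (integrable_finsetSum _ fun j _ => hI j) fun w => A.sum_loss_le i hs₀ hα ht w).trans ?_
  rw [integral_finsetSum _ fun j _ => hI j, ← Finset.sum_add_distrib]
  refine Finset.sum_le_sum fun j hj => ?_
  have hgap := P.gap_pos i (Finset.mem_compl.1 hj)
  have b1 : ∫ w, ∑ n ∈ Finset.range t, (A.overestimated i j t n).indicator (1 : Ω → ℝ) w ∂μ
      ≤ ∑' n : ℕ, Real.exp (n * -(2 * (P.gap i j / 20) ^ 2)) := by
    rw [integral_finsetSum _ fun n _ => hi1 j n]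
    simp_rw [integral_indicator_one (A.measurableSet_overestimated i j t _)]
    exact (Finset.sum_le_sum fun n _ => A.measureReal_overestimated_le i
      (Finset.mem_compl.1 hj) t n).trans
        ((hsum1 j hj).sum_le_tsum _ fun n _ => (Real.exp_pos _).le)
  have b2 : ∫ w, ∑ s ∈ Finset.range t, ∑ l ∈ P.topSet i,
      (A.underestimated i l s).indicator (1 : Ω → ℝ) w ∂μ
      ≤ (P.topSet i).card * ∑' s : ℕ, ((s : ℝ) ^ 3)⁻¹ := by
    rw [integral_finsetSum _ fun s _ => integrable_finsetSum _ fun l _ => hi2 l s]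
    simp_rw [fun s => integral_finsetSum (P.topSet i) fun l _ => hi2 l s,
      integral_indicator_one (A.measurableSet_underestimated i _ _)]
    calc _ ≤ ∑ s ∈ Finset.range t, ∑ l ∈ P.topSet i, ((s : ℝ) ^ 3)⁻¹ := by
            gcongr; exact A.measureReal_underestimated_le i _ _
      _ = (P.topSet i).card * ∑ s ∈ Finset.range t, ((s : ℝ) ^ 3)⁻¹ := by
            simp [Finset.mul_sum]
      _ ≤ _ := by
            gcongr
            exact hsum2.sum_le_tsum _ fun n _ => by positivity
  have b3 : 6 * Real.log t / P.gap i j ≤ ⌈(6 + ε) * Real.log t / P.gap i j⌉ :=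
    le_trans (by gcongr; linarith) (Int.le_ceil _)
  have hI1' : Integrable (fun w => 6 * Real.log t / P.gap i j + 1
      + ∑ n ∈ Finset.range t, (A.overestimated i j t n).indicator (1 : Ω → ℝ) w) μ :=
    (integrable_const _).add (hI1 j)
  have hI2' : Integrable (fun w => (s₀ : ℝ) + ∑ s ∈ Finset.range t, ∑ l ∈ P.topSet i,
      (A.underestimated i l s).indicator (1 : Ω → ℝ) w) μ :=
    (integrable_const _).add hI2
  rw [integral_add hI1' hI2', integral_add (integrable_const _) (hI1 j),
    integral_add (integrable_const _) hI2]
  simp only [integral_const, probReal_univ, one_smul]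
  linarith
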